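/- Let $(X,\mathfrak A,\mu)$ and $(Y,\mathfrak B,\nu)$ be atomless Lebesgue--Rokhlin probability spaces, i.e. complete probability spaces isomorphic mod $0$ to $[0,1]$ with the Lebesgue measure. A set $W\subset X\times Y$, measurable with respect to the completion of $\mu\times\nu$, is called virtually open if there are sets $X'\subset X$, $Y'\subset Y$ of full measure such that $W\cap(X'\times Y')$ is a countable union of measurable rectangles $A_i\times B_i$ ($A_i\in\mathfrak A$, $B_i\in\mathfrak B$); a set is virtually closed if its complement is virtually open. The proper thickness of $Z\subset X\times Y$ is $$\mathrm{sthi}(Z)=\inf\{\mu(S)+\nu(T)\colon S\in\mathfrak A,\ T\in\mathfrak B,\ Z\subset (S\times Y)\cup(X\times T)\}.$$ A measure $\lambda$ on the product $\sigma$-algebra $\mathfrak A\otimes\mathfrak B$ is called bistochastic if its projections to $X$ and $Y$ are $\mu$ and $\nu$. Let $Z\subset X\times Y$ be virtually closed. Then $Z$ is measurable with respect to the completion of every bistochastic measure (so that $\lambda(Z)$ is defined for every bistochastic $\lambda$), and: 1. (Continuous Hall lemma) There exists a bistochastic measure $\lambda$ with $\lambda(Z)=1$ if and only if $\mathrm{sthi}(Z)=1$.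 2. One has $\max_\lambda \lambda(Z)=\mathrm{sthi}(Z)$, where the maximum is taken over all bistochastic measures $\lambda$ and is attained. -/

import Mathlib

open MeasureTheory
open scoped ENNReal

/-- `(X, μ)` is an atomless Lebesgue--Rokhlin probability space: a complete probability space that
is isomorphic mod `0` to the unit interval with the Lebesgue measure. Lebesgue measurable subsets of
the interval are the null-measurable sets of `volume`, so the isomorphism `f : X₀ → f '' X₀` is
required to match the measurable subsets of `X₀` with them, preserving the measure. -/
structure IsLebesgueRokhlin {X : Type*} [MeasurableSpace X] (μ : Measure X) : Prop where
  isProbabilityMeasure : IsProbabilityMeasure μ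
  isComplete : μ.IsComplete
  exists_iso : ∃ (X₀ : Set X) (f : X → unitInterval),
    MeasurableSet X₀ ∧ μ X₀ᶜ = 0 ∧ Set.InjOn f X₀ ∧
    (volume : Measure unitInterval) (f '' X₀)ᶜ = 0 ∧
    (∀ A ⊆ X₀, MeasurableSet A ↔ NullMeasurableSet (f '' A) (volume : Measure unitInterval)) ∧
    (∀ A ⊆ X₀, MeasurableSet A → (volume : Measure unitInterval) (f '' A) = μ A)

/-- A measurable set `Z ⊆ X × Y` is virtually open if, on the product of some sets of full
measure, it is a countable union of measurable rectangles. Measurability of `Z` is with respect to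
the completion of `μ × ν`. -/
def IsVirtuallyOpen {X Y : Type*} [MeasurableSpace X] [MeasurableSpace Y]
    (μ : Measure X) (ν : Measure Y) (Z : Set (X × Y)) : Prop :=
  NullMeasurableSet Z (μ.prod ν) ∧
  ∃ (X' : Set X) (Y' : Set Y), MeasurableSet X' ∧ MeasurableSet Y' ∧ μ X'ᶜ = 0 ∧ ν Y'ᶜ = 0 ∧
    ∃ (A : ℕ → Set X) (B : ℕ → Set Y),
      (∀ i, MeasurableSet (A i)) ∧ (∀ i, MeasurableSet (B i)) ∧
      Z ∩ (X' ×ˢ Y') = ⋃ i, A i ×ˢ B i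

/-- A set is virtually closed if its complement is virtually open. -/
def IsVirtuallyClosed {X Y : Type*} [MeasurableSpace X] [MeasurableSpace Y]
    (μ : Measure X) (ν : Measure Y) (Z : Set (X × Y)) : Prop :=
  IsVirtuallyOpen μ ν Zᶜ

/-- The proper thickness of `Z ⊆ X × Y`: the infimum of `μ(S) + ν(T)` over measurable `S ⊆ X`,
`T ⊆ Y` with `Z ⊆ (S × Y) ∪ (X × T)`. -/
noncomputable def properThickness {X Y : Type*} [MeasurableSpace X] [MeasurableSpace Y]
    (μ : Measure X) (ν : Measure Y) (Z : Set (X × Y)) : ℝ≥0∞ :=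
  sInf {r | ∃ (S : Set X) (T : Set Y), MeasurableSet S ∧ MeasurableSet T ∧
    Z ⊆ (S ×ˢ Set.univ) ∪ (Set.univ ×ˢ T) ∧ r = μ S + ν T}

/-- A measure on `X × Y` is bistochastic if its marginals are `μ` and `ν`. -/
def IsBistochastic {X Y : Type*} [MeasurableSpace X] [MeasurableSpace Y]
    (μ : Measure X) (ν : Measure Y) (lam : Measure (X × Y)) : Prop :=
  lam.map Prod.fst = μ ∧ lam.map Prod.snd = ν

/-! The bound λ(Z) ≤ sthi(Z) is a union bound over any cover of Z by two strips, whose λ-masses are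
fixed by the marginals. The work lies in finding a λ with λ(Z) ≥ sthi(Z).

Off null strips, the complement of Z is a union of rectangles A_i × B_i. The first n of them cut X
and Y into finitely many cells, and avoiding them is a relation between cells. Weighted König
duality, a finite max-flow min-cut, gives a coupling of the cell masses whose mass on the relation
is at least that of some cover by cells (`exists_coupling_cover_le`). Spreading it uniformly inside
the cells gives a bistochastic λ_n. The cover also covers Z once null strips are added, so λ_n gives
mass at least sthi(Z) to the set K_n avoiding the first n rectangles.

Since K_n decreases to Z up to null strips, a limit of the λ_n should work, but upper semicontinuity
of mass needs compactness and closed K_n. Both are arranged by adjoining to a point of [0,1] the 0-1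
sequence of its memberships in the A_i (or the B_i): the rectangles become clopen cylinders in a
compact space. The weak limit taken there is carried back by almost everywhere inverses of the
codings. -/

/-! ### Finite transport and König duality -/

/-- The weighted König theorem: some transport plan supported on `R`, with marginals bounded by
`p` and `q`, has the same total mass as some cover of `R` by rows and columns. -/
theorem exists_transport_eq_cover {ι κ : Type*} [Fintype ι] [Fintype κ]
    (p : ι → ℝ) (q : κ → ℝ) (hp : ∀ i, 0 ≤ p i) (hq : ∀ j, 0 ≤ q j) (R : ι → κ → Prop) :
    ∃ M : ι → κ → ℝ, (∀ i j, 0 ≤ M i j) ∧ (∀ i j, ¬ R i j → M i j = 0) ∧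
      (∀ i, ∑ j, M i j ≤ p i) ∧ (∀ j, ∑ i, M i j ≤ q j) ∧
      ∃ (S : Finset ι) (T : Finset κ), (∀ i j, R i j → i ∈ S ∨ j ∈ T) ∧
        ∑ i ∈ S, p i + ∑ j ∈ T, q j = ∑ i, ∑ j, M i j := by
  classical
  let F : Set (ι → κ → ℝ) := {M | (∀ i j, 0 ≤ M i j) ∧ (∀ i j, ¬ R i j → M i j = 0) ∧
      (∀ i, ∑ j, M i j ≤ p i) ∧ (∀ j, ∑ i, M i j ≤ q j)}
  have hFcl : IsClosed F := by
    simp only [F, Set.ofPred_and, Set.ofPred_forall]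
    refine IsClosed.inter ?_ (IsClosed.inter ?_ (IsClosed.inter ?_ ?_))
    · exact isClosed_iInter fun i => isClosed_iInter fun j =>
        isClosed_le continuous_const (by fun_prop)
    · exact isClosed_iInter fun i => isClosed_iInter fun j => isClosed_iInter fun _ =>
        isClosed_eq (by fun_prop) continuous_const
    · exact isClosed_iInter fun i => isClosed_le (by fun_prop) continuous_const
    · exact isClosed_iInter fun i => isClosed_le (by fun_prop) continuous_const
  have hFcpt : IsCompact F := by
    refine (isCompact_Icc (a := (0 : ι → κ → ℝ)) (b := fun i _ => p i)).of_isClosed_subset hFcl ?_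
    rintro M ⟨h0, -, hr, -⟩
    exact ⟨fun i j => h0 i j, fun i j =>
      (Finset.single_le_sum (f := fun j => M i j) (fun j _ => h0 i j) (Finset.mem_univ j)).trans
        (hr i)⟩
  have hFne : F.Nonempty := ⟨0, by simp, by simp, by simpa using hp, by simpa using hq⟩
  let mass : (ι → κ → ℝ) → ℝ := fun M => ∑ i, ∑ j, M i j
  obtain ⟨M₀, hM₀F, hM₀⟩ := hFcpt.exists_isMaxOn hFne
    (f := mass) (by fun_prop)
  let slack : (ι → κ → ℝ) → Finset ι := fun M => {i | ∑ j, M i j < p i}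
  let O : Set (ι → κ → ℝ) := {M | M ∈ F ∧ mass M = mass M₀}
  -- Maximising the number of slack rows among optimal plans replaces the search for augmenting
  -- paths: every one-step exchange below would create a further slack row.
  obtain ⟨M, ⟨hMF, hMm⟩, hMs⟩ : ∃ M ∈ O, ∀ N ∈ O, (slack N).card ≤ (slack M).card := by
    have hfin : ((fun M => (slack M).card) '' O).Finite :=
      (Set.finite_Iic (Fintype.card ι)).subset (by
        rintro _ ⟨M, -, rfl⟩
        exact Finset.card_le_univ _)
    obtain ⟨_, ⟨M, hM, rfl⟩, h⟩ := Set.exists_max_image _ id hfin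
      ((show O.Nonempty from ⟨M₀, hM₀F, rfl⟩).image _)
    exact ⟨M, hM, fun N hN => h _ ⟨N, hN, rfl⟩⟩
  have hmax : ∀ N ∈ F, mass N ≤ mass M := fun N hN => hMm ▸ hM₀ hN
  obtain ⟨h0, hR, hr, hc⟩ := hMF
  -- a column meeting a slack row is tight
  have hcol : ∀ i j, i ∈ slack M → R i j → ∑ i', M i' j = q j := by
    intro i j hi hij
    by_contra hne
    have hlt : ∑ i', M i' j < q j := lt_of_le_of_ne (hc j) hne
    have hi' : ∑ j', M i j' < p i := by simpa [slack] using hi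
    obtain ⟨ε, hε, h1, h2⟩ : ∃ ε : ℝ, 0 < ε ∧ ε ≤ p i - ∑ j', M i j' ∧ ε ≤ q j - ∑ i', M i' j :=
      ⟨min _ _, lt_min (sub_pos.2 hi') (sub_pos.2 hlt), min_le_left _ _, min_le_right _ _⟩
    let N : ι → κ → ℝ := fun a b => M a b + if a = i ∧ b = j then ε else 0
    have hrow : ∀ a, ∑ b, N a b = ∑ b, M a b + if a = i then ε else 0 := by
      intro a
      by_cases ha : a = i <;> simp [N, Finset.sum_add_distrib, ha]
    have hcl : ∀ b, ∑ a, N a b = ∑ a, M a b + if b = j then ε else 0 := by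
      intro b
      by_cases hb : b = j <;> simp [N, Finset.sum_add_distrib, hb]
    have hNF : N ∈ F := by
      refine ⟨fun a b => ?_, fun a b hab => ?_, fun a => ?_, fun b => ?_⟩
      · have := h0 a b
        dsimp only [N]; split_ifs <;> linarith
      · have : ¬ (a = i ∧ b = j) := by rintro ⟨rfl, rfl⟩; exact hab hij
        simp [N, this, hR a b hab]
      · rw [hrow]; split_ifs with h
        · subst h; linarith
        · simpa using hr a
      · rw [hcl]; split_ifs with h
        · subst h; linarith
        · simpa using hc b
    have := hmax N hNF
    simp only [mass, hrow, Finset.sum_add_distrib] at this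
    simp at this
    linarith
  -- mass in such a column only comes from slack rows
  have hshift : ∀ i j i', i ∈ slack M → R i j → i' ∉ slack M → M i' j = 0 := by
    intro i j i' hi hij hi'
    by_contra hne
    have hpos : 0 < M i' j := lt_of_le_of_ne (h0 _ _) (Ne.symm hne)
    have hii : i' ≠ i := by rintro rfl; exact hi' hi
    have hsl : ∑ j', M i j' < p i := by simpa [slack] using hi
    -- Moving ε within column j from the tight row i' to the slack row i keeps the total mass and
    -- makes i' slack. The bound by the slack of i is strict, hence the half, so that i stays slack
    -- too.
    obtain ⟨ε, hε, h1, h2⟩ : ∃ ε : ℝ, 0 < ε ∧ ε < p i - ∑ j', M i j' ∧ ε ≤ M i' j := by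
      refine ⟨min ((p i - ∑ j', M i j') / 2) (M i' j), lt_min (half_pos (sub_pos.2 hsl)) hpos,
        (min_le_left _ _).trans_lt (half_lt_self (sub_pos.2 hsl)), min_le_right _ _⟩
    let N : ι → κ → ℝ := fun a b => M a b + ((if a = i ∧ b = j then ε else 0) -
      if a = i' ∧ b = j then ε else 0)
    have hrow : ∀ a, ∑ b, N a b = ∑ b, M a b +
        ((if a = i then ε else 0) - if a = i' then ε else 0) := by
      intro a
      by_cases ha : a = i <;> by_cases ha' : a = i' <;>
        simp [N, Finset.sum_add_distrib, ha, ha', hii, hii.symm]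
    have hcl : ∀ b, ∑ a, N a b = ∑ a, M a b := by
      intro b
      by_cases hb : b = j <;>
        simp [N, Finset.sum_add_distrib, Finset.sum_sub_distrib, hb]
    have hNF : N ∈ F := by
      refine ⟨fun a b => ?_, fun a b hab => ?_, fun a => ?_, fun b => ?_⟩
      · have := h0 a b
        by_cases h : a = i' ∧ b = j
        · obtain ⟨rfl, rfl⟩ := h
          simp [N, hii]; linarith
        · simp only [N, h, if_false]
          split_ifs <;> linarith
      · have h1 : ¬ (a = i ∧ b = j) := by rintro ⟨rfl, rfl⟩; exact hab hij
        have h2 : ¬ (a = i' ∧ b = j) := by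
          rintro ⟨rfl, rfl⟩; exact hne (hR _ _ hab)
        simp [N, h1, h2, hR a b hab]
      · rw [hrow]
        have := hr a
        by_cases h : a = i
        · subst h
          simp [hii.symm]; linarith
        · simp only [h, if_false]; split_ifs <;> linarith
      · rw [hcl]; exact hc b
    have hNO : N ∈ O := by
      refine ⟨hNF, ?_⟩
      rw [← hMm]
      simp [mass, hrow, Finset.sum_add_distrib, Finset.sum_sub_distrib]
    have hlt : (slack M).card < (slack N).card := by
      refine Finset.card_lt_card (Finset.ssubset_iff.2 ⟨i', hi', ?_⟩)
      intro a ha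
      simp only [slack, Finset.mem_filter, Finset.mem_univ, true_and, Finset.mem_insert] at ha ⊢
      rw [hrow]
      by_cases h : a = i'
      · subst h
        simp [hii]
        linarith [hr a]
      · have ha := ha.resolve_left h
        by_cases h' : a = i
        · subst h'; simp [h]; linarith
        · simpa [h, h'] using ha
    exact absurd (hMs N hNO) (not_le.2 hlt)
  -- The cover consists of the tight rows and the columns related to a slack row. Those columns are
  -- full and fed only by slack rows, while slack rows put mass nowhere else, so each unit of mass
  -- is counted exactly once.
  let T : Finset κ := {j | ∃ i ∈ slack M, R i j}
  refine ⟨M, h0, hR, hr, hc, (slack M)ᶜ, T, fun i j hij => ?_, ?_⟩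
  · by_cases hi : i ∈ slack M
    · right
      simp only [T, Finset.mem_filter, Finset.mem_univ, true_and]
      exact ⟨i, hi, hij⟩
    · left; simpa using hi
  · have hS : ∑ i ∈ (slack M)ᶜ, p i = ∑ i ∈ (slack M)ᶜ, ∑ j, M i j := by
      refine Finset.sum_congr rfl fun i hi => le_antisymm ?_ (hr i)
      simpa [slack] using hi
    have hT : ∑ j ∈ T, q j = ∑ i ∈ slack M, ∑ j, M i j := by
      rw [Finset.sum_comm, ← Finset.sum_subset (Finset.subset_univ T)]
      · refine Finset.sum_congr rfl fun j hj => ?_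
        obtain ⟨i, hi, hij⟩ : ∃ i ∈ slack M, R i j := by simpa [T] using hj
        rw [← hcol i j hi hij]
        exact (Finset.sum_subset (Finset.subset_univ _)
          fun i' _ hi' => hshift i j i' hi hij hi').symm
      · intro j _ hj
        refine Finset.sum_eq_zero fun i hi => hR i j fun hij => hj ?_
        simp only [T, Finset.mem_filter, Finset.mem_univ, true_and]
        exact ⟨i, hi, hij⟩
    rw [hS, hT, add_comm]
    exact Finset.sum_add_sum_compl _ _

/-- A coupling of two probability vectors whose mass on `R` is at least that of a cover of `R`. -/
theorem exists_coupling_cover_le {ι κ : Type*} [Fintype ι] [Fintype κ]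
    (p : ι → ℝ) (q : κ → ℝ) (hp : ∀ i, 0 ≤ p i) (hq : ∀ j, 0 ≤ q j)
    (hp1 : ∑ i, p i = 1) (hq1 : ∑ j, q j = 1) (R : ι → κ → Prop) [∀ i j, Decidable (R i j)] :
    ∃ M : ι → κ → ℝ, (∀ i j, 0 ≤ M i j) ∧
      (∀ i, ∑ j, M i j = p i) ∧ (∀ j, ∑ i, M i j = q j) ∧
      ∃ (S : Finset ι) (T : Finset κ), (∀ i j, R i j → i ∈ S ∨ j ∈ T) ∧
        ∑ i ∈ S, p i + ∑ j ∈ T, q j ≤ ∑ i, ∑ j, if R i j then M i j else 0 := by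
  obtain ⟨M, h0, hR, hr, hc, S, T, hcov, hST⟩ := exists_transport_eq_cover p q hp hq R
  set m := ∑ i, ∑ j, M i j with hm
  have hpm : ∑ i, (p i - ∑ j, M i j) = 1 - m := by rw [Finset.sum_sub_distrib, hp1]
  have hqm : ∑ j, (q j - ∑ i, M i j) = 1 - m := by
    rw [Finset.sum_sub_distrib, hq1, hm, Finset.sum_comm]
  have hp' : ∀ i, 0 ≤ p i - ∑ j, M i j := fun i => sub_nonneg.2 (hr i)
  have hq' : ∀ j, 0 ≤ q j - ∑ i, M i j := fun j => sub_nonneg.2 (hc j)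
  have hm1 : 0 ≤ 1 - m := hpm ▸ Finset.sum_nonneg fun i _ => hp' i
  have hD : ∀ i j, 0 ≤ (p i - ∑ j, M i j) * (q j - ∑ i, M i j) / (1 - m) := fun i j =>
    div_nonneg (mul_nonneg (hp' i) (hq' j)) hm1
  -- Row and column deficits both total 1 - m, so their normalised product fills them. If m = 1 all
  -- deficits vanish, and division by zero gives the correct correction 0.
  refine ⟨fun i j => M i j + (p i - ∑ j, M i j) * (q j - ∑ i, M i j) / (1 - m),
    fun i j => add_nonneg (h0 i j) (hD i j), fun i => ?_, fun j => ?_, S, T, hcov, ?_⟩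
  · rw [Finset.sum_add_distrib, ← Finset.sum_div, ← Finset.mul_sum, hqm]
    by_cases h : 1 - m = 0
    · have := (Finset.sum_eq_zero_iff_of_nonneg fun i _ => hp' i).1 (hpm.trans h) i
        (Finset.mem_univ i)
      rw [h, div_zero]; linarith
    · rw [mul_div_cancel_right₀ _ h]; ring
  · rw [Finset.sum_add_distrib, ← Finset.sum_div, ← Finset.sum_mul, hpm]
    by_cases h : 1 - m = 0
    · have := (Finset.sum_eq_zero_iff_of_nonneg fun i _ => hq' i).1 (hqm.trans h) j
        (Finset.mem_univ j)
      rw [h, div_zero]; linarith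
    · rw [mul_div_cancel_left₀ _ h]; ring
  · rw [hST]
    refine Finset.sum_le_sum fun i _ => Finset.sum_le_sum fun j _ => ?_
    split_ifs with h
    · linarith [hD i j]
    · rw [hR i j h]

/-! ### From matrices to bistochastic measures -/

/-- A relation between the cells of two finite partitions carries a coupling whose mass is at least
the mass of a cover of the relation by cells. -/
theorem exists_isBistochastic_cover_le {X Y : Type*} [MeasurableSpace X] [MeasurableSpace Y]
    (μ : Measure X) (ν : Measure Y) [IsProbabilityMeasure μ] [IsProbabilityMeasure ν]
    {ι κ : Type*} [Fintype ι] [Fintype κ] [MeasurableSpace ι] [MeasurableSpace κ]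
    [MeasurableSingletonClass ι] [MeasurableSingletonClass κ]
    {π : X → ι} {ρ : Y → κ} (hπ : Measurable π) (hρ : Measurable ρ) (R : ι → κ → Prop) :
    ∃ lam : Measure (X × Y), IsBistochastic μ ν lam ∧
      ∃ (S : Set ι) (T : Set κ), (∀ i j, R i j → i ∈ S ∨ j ∈ T) ∧
        μ (π ⁻¹' S) + ν (ρ ⁻¹' T) ≤ lam {z | R (π z.1) (ρ z.2)} := by
  classical
  have hA : ∀ i, MeasurableSet (π ⁻¹' {i}) := fun i => hπ (measurableSet_singleton i)
  have hB : ∀ j, MeasurableSet (ρ ⁻¹' {j}) := fun j => hρ (measurableSet_singleton j)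
  let p : ι → ℝ := fun i => μ.real (π ⁻¹' {i})
  let q : κ → ℝ := fun j => ν.real (ρ ⁻¹' {j})
  have hμs : ∀ s : Set X, MeasurableSet s → ∑ i, μ (s ∩ π ⁻¹' {i}) = μ s := by
    intro s hs
    have := sum_measure_preimage_singleton (μ := μ.restrict s) (f := π) Finset.univ
      (fun i _ => hA i)
    simpa [Measure.restrict_apply, hA, Set.inter_comm] using this
  have hνs : ∀ s : Set Y, MeasurableSet s → ∑ i, ν (s ∩ ρ ⁻¹' {i}) = ν s := by
    intro s hs
    have := sum_measure_preimage_singleton (μ := ν.restrict s) (f := ρ) Finset.univ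
      (fun i _ => hB i)
    simpa [Measure.restrict_apply, hB, Set.inter_comm] using this
  have hpo : ∀ i, μ (π ⁻¹' {i}) = ENNReal.ofReal (p i) := fun i => by simp [p]
  have hqo : ∀ j, ν (ρ ⁻¹' {j}) = ENNReal.ofReal (q j) := fun i => by simp [q]
  have hp0 : ∀ i, 0 ≤ p i := fun i => measureReal_nonneg
  have hq0 : ∀ j, 0 ≤ q j := fun i => measureReal_nonneg
  have hp1 : ∑ i, p i = 1 := by
    rw [← ENNReal.ofReal_eq_one, ENNReal.ofReal_sum_of_nonneg fun i _ => hp0 i]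
    simpa [hpo] using hμs Set.univ .univ
  have hq1 : ∑ i, q i = 1 := by
    rw [← ENNReal.ofReal_eq_one, ENNReal.ofReal_sum_of_nonneg fun i _ => hq0 i]
    simpa [hqo] using hνs Set.univ .univ
  obtain ⟨M, h0, hr, hc, S, T, hcov, hST⟩ :=
    exists_coupling_cover_le p q hp0 hq0 hp1 hq1 R
  have hMp : ∀ i j, p i = 0 → M i j = 0 := fun i j h =>
    (Finset.sum_eq_zero_iff_of_nonneg fun j _ => h0 i j).1 ((hr i).trans h) j (Finset.mem_univ j)
  have hMq : ∀ i j, q j = 0 → M i j = 0 := fun i j h =>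
    (Finset.sum_eq_zero_iff_of_nonneg fun i _ => h0 i j).1 ((hc j).trans h) i (Finset.mem_univ i)
  -- The constant density of the coupling on a cell with respect to μ × ν. On null cells the
  -- quotient is 0, which is harmless because M vanishes there.
  let D : ι → κ → ℝ≥0∞ := fun i j => ENNReal.ofReal (M i j / (p i * q j))
  have hDq : ∀ i j, D i j * ν (ρ ⁻¹' {j}) = ENNReal.ofReal (M i j / p i) := by
    intro i j
    rw [hqo, ← ENNReal.ofReal_mul (div_nonneg (h0 i j) (mul_nonneg (hp0 i) (hq0 j)))]
    congr 1
    by_cases h : q j = 0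
    · simp [h, hMq i j h]
    · rw [← div_div, div_mul_cancel₀ _ h]
  have hDp : ∀ i j, D i j * μ (π ⁻¹' {i}) = ENNReal.ofReal (M i j / q j) := by
    intro i j
    rw [hpo, ← ENNReal.ofReal_mul (div_nonneg (h0 i j) (mul_nonneg (hp0 i) (hq0 j)))]
    congr 1
    by_cases h : p i = 0
    · simp [h, hMp i j h]
    · rw [mul_comm (p i), ← div_div, div_mul_cancel₀ _ h]
  have hrow : ∀ i, p i ≠ 0 → ∑ j, D i j * ν (ρ ⁻¹' {j}) = 1 := by
    intro i hi
    simp_rw [hDq]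
    rw [← ENNReal.ofReal_sum_of_nonneg fun j _ => div_nonneg (h0 i j) (hp0 i), ← Finset.sum_div,
      hr, div_self hi, ENNReal.ofReal_one]
  have hcl : ∀ j, q j ≠ 0 → ∑ i, D i j * μ (π ⁻¹' {i}) = 1 := by
    intro j hj
    simp_rw [hDp]
    rw [← ENNReal.ofReal_sum_of_nonneg fun i _ => div_nonneg (h0 i j) (hq0 j), ← Finset.sum_div,
      hc, div_self hj, ENNReal.ofReal_one]
  let lam : Measure (X × Y) := ∑ i, ∑ j,
    D i j • (μ.restrict (π ⁻¹' {i})).prod (ν.restrict (ρ ⁻¹' {j}))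
  have hlam : ∀ s : Set (X × Y), lam s = ∑ i, ∑ j,
      D i j * (μ.restrict (π ⁻¹' {i})).prod (ν.restrict (ρ ⁻¹' {j})) s := fun s => by
    simp [lam]
  refine ⟨lam, ⟨?_, ?_⟩, S, T, by simpa using hcov, ?_⟩
  · ext s hs
    rw [Measure.map_apply measurable_fst hs, hlam, ← hμs s hs]
    refine Finset.sum_congr rfl fun i _ => ?_
    rw [← Set.prod_univ]
    simp_rw [Measure.prod_prod, Measure.restrict_apply hs, Measure.restrict_apply_univ]
    by_cases hi : p i = 0
    · have : μ (s ∩ π ⁻¹' {i}) = 0 := measure_mono_null Set.inter_subset_right (by simp [hpo, hi])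
      simp [this]
    · calc _ = (∑ j, D i j * ν (ρ ⁻¹' {j})) * μ (s ∩ π ⁻¹' {i}) := by
            rw [Finset.sum_mul]
            exact Finset.sum_congr rfl fun j _ => by ring
        _ = _ := by rw [hrow i hi, one_mul]
  · ext s hs
    rw [Measure.map_apply measurable_snd hs, hlam, ← hνs s hs, Finset.sum_comm]
    refine Finset.sum_congr rfl fun j _ => ?_
    rw [← Set.univ_prod]
    simp_rw [Measure.prod_prod, Measure.restrict_apply hs, Measure.restrict_apply_univ]
    by_cases hj : q j = 0
    · have : ν (s ∩ ρ ⁻¹' {j}) = 0 := measure_mono_null Set.inter_subset_right (by simp [hqo, hj])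
      simp [this]
    · calc _ = (∑ i, D i j * μ (π ⁻¹' {i})) * ν (s ∩ ρ ⁻¹' {j}) := by
            rw [Finset.sum_mul]
            exact Finset.sum_congr rfl fun j _ => by ring
        _ = _ := by rw [hcl j hj, one_mul]
  · have hS : μ (π ⁻¹' S) = ENNReal.ofReal (∑ i ∈ S, p i) := by
      rw [ENNReal.ofReal_sum_of_nonneg fun i _ => hp0 i,
        ← sum_measure_preimage_singleton S fun i _ => hA i]
      exact Finset.sum_congr rfl fun i _ => hpo i
    have hT : ν (ρ ⁻¹' T) = ENNReal.ofReal (∑ j ∈ T, q j) := by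
      rw [ENNReal.ofReal_sum_of_nonneg fun i _ => hq0 i,
        ← sum_measure_preimage_singleton T fun i _ => hB i]
      exact Finset.sum_congr rfl fun i _ => hqo i
    rw [hS, hT, ← ENNReal.ofReal_add (Finset.sum_nonneg fun i _ => hp0 i)
      (Finset.sum_nonneg fun i _ => hq0 i)]
    refine (ENNReal.ofReal_le_ofReal hST).trans ?_
    have h1 : ∀ i j, 0 ≤ if R i j then M i j else 0 := fun i j => by
      split_ifs
      exacts [h0 i j, le_rfl]
    rw [hlam, ENNReal.ofReal_sum_of_nonneg fun i _ => Finset.sum_nonneg fun j _ => h1 i j]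
    refine Finset.sum_le_sum fun i _ => ?_
    rw [ENNReal.ofReal_sum_of_nonneg fun j _ => h1 i j]
    refine Finset.sum_le_sum fun j _ => ?_
    split_ifs with hij
    · have hsub : (π ⁻¹' {i}) ×ˢ (ρ ⁻¹' {j}) ⊆ {z : X × Y | R (π z.1) (ρ z.2)} := by
        rintro ⟨x, y⟩ ⟨hx, hy⟩
        simp only [Set.mem_preimage, Set.mem_singleton_iff] at hx hy
        simpa [hx, hy] using hij
      refine le_trans ?_ (mul_le_mul_right (measure_mono hsub) _)
      rw [Measure.prod_prod, Measure.restrict_apply_self, Measure.restrict_apply_self,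
        mul_comm (μ _), ← mul_assoc, hDq, hpo,
        ← ENNReal.ofReal_mul (div_nonneg (h0 i j) (hp0 i))]
      refine ENNReal.ofReal_le_ofReal (le_of_eq ?_)
      by_cases h : p i = 0
      · simp [h, hMp i j h]
      · rw [div_mul_cancel₀ _ h]
    · simp

/-! ### Compact models and transfer of couplings -/

/-- A Lebesgue–Rokhlin space, together with a sequence of measurable sets, has a compact
metrizable model, in which the sets become clopen cylinders. -/
theorem IsLebesgueRokhlin.exists_compact_model {X : Type*} [MeasurableSpace X] {μ : Measure X}
    (hμ : IsLebesgueRokhlin μ) (A : ℕ → Set X) (hA : ∀ i, MeasurableSet (A i)) :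
    ∃ (g : X → unitInterval × (ℕ → Bool)) (h : unitInterval × (ℕ → Bool) → X),
      Measurable g ∧ (∀ x i, (g x).2 i = true ↔ x ∈ A i) ∧
      (∀ s, MeasurableSet s → NullMeasurableSet (h ⁻¹' s) (μ.map g)) ∧
      ∀ᵐ x ∂μ, h (g x) = x := by
  classical
  have := hμ.isProbabilityMeasure
  obtain ⟨X₀, f, hX₀, hX₀c, hinj, hfc, hms, hvol⟩ := hμ.exists_iso
  obtain ⟨x₀⟩ : Nonempty X := by
    by_contra hX
    rw [not_nonempty_iff] at hX
    have h1 : μ Set.univ = 1 := measure_univ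
    rw [Set.univ_eq_empty_iff.2 hX, measure_empty] at h1
    exact zero_ne_one h1
  have : Nonempty X := ⟨x₀⟩
  have hfull : NullMeasurableSet (f '' X₀) (volume : Measure unitInterval) :=
    (NullMeasurableSet.of_null hfc).of_compl
  -- Nothing is known about f off X₀, so it is replaced there by a constant to be measurable
  -- everywhere.
  let f' : X → unitInterval := fun x => if x ∈ X₀ then f x else 0
  have hf'X : ∀ x ∈ X₀, f' x = f x := fun x hx => if_pos hx
  have himg : ∀ s : Set unitInterval, f '' (X₀ ∩ f ⁻¹' s) = f '' X₀ ∩ s := fun s =>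
    Set.image_inter_preimage f X₀ s
  have hpre : ∀ s, MeasurableSet s → MeasurableSet (X₀ ∩ f ⁻¹' s) := fun s hs =>
    (hms _ Set.inter_subset_left).2 (himg s ▸ hfull.inter hs.nullMeasurableSet)
  have hf' : Measurable f' := by
    intro s hs
    have : f' ⁻¹' s = (X₀ ∩ f ⁻¹' s) ∪ (X₀ᶜ ∩ {_x | (0 : unitInterval) ∈ s}) := by
      ext x
      by_cases hx : x ∈ X₀ <;> simp [f', hx]
    rw [this]
    exact (hpre s hs).union (hX₀.compl.inter (MeasurableSet.const _))
  have hae : ∀ᵐ x ∂μ, x ∈ X₀ := hX₀c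
  have hf'map : μ.map f' = volume := by
    ext s hs
    rw [Measure.map_apply hf' hs]
    calc μ (f' ⁻¹' s) = μ (X₀ ∩ f ⁻¹' s) := by
          refine measure_congr ?_
          filter_upwards [hae] with x hx
          change (f' x ∈ s) = (x ∈ X₀ ∧ f x ∈ s)
          simp [hf'X x hx, hx]
      _ = volume (f '' X₀ ∩ s) := by rw [← himg, hvol _ Set.inter_subset_left (hpre s hs)]
      _ = volume s := by
          rw [Set.inter_comm]
          exact measure_inter_conull hfc
  let g : X → unitInterval × (ℕ → Bool) := fun x => (f' x, fun i => decide (x ∈ A i))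
  have hg : Measurable g := by
    refine hf'.prodMk (measurable_pi_lambda _ fun i => ?_)
    refine measurable_to_bool ?_
    convert hA i
    ext x; simp
  -- The inverse ignores the code, since the first coordinate already determines the point almost
  -- everywhere. It is only null-measurable: f sends measurable sets to Lebesgue measurable ones.
  refine ⟨g, fun z => Function.invFunOn f X₀ z.1, hg, fun x i => by simp [g], fun s hs => ?_, ?_⟩
  · have hq : Measure.QuasiMeasurePreserving (Prod.fst : unitInterval × (ℕ → Bool) → unitInterval)
        (μ.map g) volume := by
      refine ⟨measurable_fst, ?_⟩
      rw [Measure.map_map measurable_fst hg]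
      exact (hf'map.le).absolutelyContinuous
    refine NullMeasurableSet.preimage (s := Function.invFunOn f X₀ ⁻¹' s) ?_ hq
    have h1 : NullMeasurableSet (f '' (s ∩ X₀)) (volume : Measure unitInterval) :=
      (hms _ Set.inter_subset_right).1 (hs.inter hX₀)
    refine h1.congr ?_
    have hfae : ∀ᵐ t ∂(volume : Measure unitInterval), t ∈ f '' X₀ := hfc
    filter_upwards [hfae] with t ht
    obtain ⟨x, hx, rfl⟩ := ht
    refine propext ⟨?_, fun h => ⟨x, ⟨?_, hx⟩, rfl⟩⟩
    · rintro ⟨y, ⟨hys, hy⟩, hyx⟩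
      obtain rfl := hinj hy hx hyx
      change Function.invFunOn f X₀ (f y) ∈ s
      rwa [hinj.leftInvOn_invFunOn hy]
    · change Function.invFunOn f X₀ (f x) ∈ s at h
      rwa [hinj.leftInvOn_invFunOn hx] at h
  · filter_upwards [hae] with x hx
    simp only [g, hf'X x hx]
    exact hinj.leftInvOn_invFunOn hx

/-- Couplings of image measures pull back along null-measurable almost everywhere inverses. -/
theorem exists_isBistochastic_of_map {X Y P Q : Type*} [MeasurableSpace X] [MeasurableSpace Y]
    [MeasurableSpace P] [MeasurableSpace Q] {μ : Measure X} {ν : Measure Y}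
    {g : X → P} {h : P → X} {g' : Y → Q} {h' : Q → Y} (hg : Measurable g) (hg' : Measurable g')
    (hh : ∀ s, MeasurableSet s → NullMeasurableSet (h ⁻¹' s) (μ.map g))
    (hh' : ∀ s, MeasurableSet s → NullMeasurableSet (h' ⁻¹' s) (ν.map g'))
    (hgh : ∀ᵐ x ∂μ, h (g x) = x) (hgh' : ∀ᵐ y ∂ν, h' (g' y) = y)
    {lam' : Measure (P × Q)} (hlam' : IsBistochastic (μ.map g) (ν.map g') lam') :
    ∃ lam : Measure (X × Y), IsBistochastic μ ν lam ∧
      ∀ s, MeasurableSet s → lam s = lam' (Prod.map h h' ⁻¹' s) := by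
  have h1 : Measure.QuasiMeasurePreserving Prod.fst lam' (μ.map g) :=
    ⟨measurable_fst, hlam'.1.le.absolutelyContinuous⟩
  have h2 : Measure.QuasiMeasurePreserving Prod.snd lam' (ν.map g') :=
    ⟨measurable_snd, hlam'.2.le.absolutelyContinuous⟩
  -- As h and h' are only null-measurable, the product map is measurable for the completion of lam',
  -- and the completed measure is the one pushed forward.
  let H : NullMeasurableSpace (P × Q) lam' → X × Y := fun z => Prod.map h h' z
  have hH : Measurable H := by
    refine Measurable.prodMk (f := fun z => h (Prod.fst z)) (g := fun z => h' (Prod.snd z)) ?_ ?_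
    · exact fun s hs => (hh s hs).preimage h1
    · exact fun s hs => (hh' s hs).preimage h2
  have happ : ∀ s, MeasurableSet s → lam'.completion.map H s = lam' (Prod.map h h' ⁻¹' s) :=
    fun s hs => by rw [Measure.map_apply hH hs, Measure.coe_completion]; rfl
  refine ⟨lam'.completion.map H, ⟨?_, ?_⟩, happ⟩
  · ext s hs
    rw [Measure.map_apply measurable_fst hs, happ _ (measurable_fst hs)]
    change lam' (Prod.fst ⁻¹' (h ⁻¹' s)) = _
    rw [← Measure.map_apply₀ measurable_fst.aemeasurable (by rw [hlam'.1]; exact hh s hs),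
      hlam'.1, Measure.map_apply₀ hg.aemeasurable (hh s hs)]
    refine measure_congr ?_
    filter_upwards [hgh] with x hx
    change (h (g x) ∈ s) = (x ∈ s)
    rw [hx]
  · ext s hs
    rw [Measure.map_apply measurable_snd hs, happ _ (measurable_snd hs)]
    change lam' (Prod.snd ⁻¹' (h' ⁻¹' s)) = _
    rw [← Measure.map_apply₀ measurable_snd.aemeasurable (by rw [hlam'.2]; exact hh' s hs),
      hlam'.2, Measure.map_apply₀ hg'.aemeasurable (hh' s hs)]
    refine measure_congr ?_
    filter_upwards [hgh'] with x hx
    change (h' (g' x) ∈ s) = (x ∈ s)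
    rw [hx]

/-! ### Facts valid for every bistochastic measure -/

theorem IsBistochastic.measure_fst_preimage {X Y : Type*} [MeasurableSpace X] [MeasurableSpace Y]
    {μ : Measure X} {ν : Measure Y} {lam : Measure (X × Y)} (h : IsBistochastic μ ν lam)
    {s : Set X} (hs : MeasurableSet s) : lam (Prod.fst ⁻¹' s) = μ s := by
  rw [← Measure.map_apply measurable_fst hs, h.1]

theorem IsBistochastic.measure_snd_preimage {X Y : Type*} [MeasurableSpace X] [MeasurableSpace Y]
    {μ : Measure X} {ν : Measure Y} {lam : Measure (X × Y)} (h : IsBistochastic μ ν lam)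
    {t : Set Y} (ht : MeasurableSet t) : lam (Prod.snd ⁻¹' t) = ν t := by
  rw [← Measure.map_apply measurable_snd ht, h.2]

theorem IsBistochastic.isProbabilityMeasure {X Y : Type*} [MeasurableSpace X] [MeasurableSpace Y]
    {μ : Measure X} {ν : Measure Y} [IsProbabilityMeasure μ] {lam : Measure (X × Y)}
    (h : IsBistochastic μ ν lam) : IsProbabilityMeasure lam :=
  ⟨by rw [← Set.preimage_univ (f := Prod.fst), h.measure_fst_preimage .univ, measure_univ]⟩

/-- Subadditivity over the two strips of a cover, whose masses are prescribed by the marginals. No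
measurability of Z is involved. -/
theorem IsBistochastic.measure_le_properThickness {X Y : Type*} [MeasurableSpace X]
    [MeasurableSpace Y] {μ : Measure X} {ν : Measure Y} {lam : Measure (X × Y)}
    (h : IsBistochastic μ ν lam) (Z : Set (X × Y)) : lam Z ≤ properThickness μ ν Z := by
  refine le_sInf ?_
  rintro _ ⟨S, T, hS, hT, hZ, rfl⟩
  rw [← h.measure_fst_preimage hS, ← h.measure_snd_preimage hT, ← Set.prod_univ, ← Set.univ_prod]
  exact (measure_mono hZ).trans (measure_union_le _ _)

theorem properThickness_le_one {X Y : Type*} [MeasurableSpace X] [MeasurableSpace Y]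
    (μ : Measure X) (ν : Measure Y) [IsProbabilityMeasure μ] (Z : Set (X × Y)) :
    properThickness μ ν Z ≤ 1 :=
  sInf_le ⟨Set.univ, ∅, .univ, .empty, by simp, by simp⟩

/-- The strips over the complements of X' and Y' are null for every bistochastic measure, however
singular to μ × ν, so W agrees almost everywhere with a countable union of rectangles. -/
theorem IsVirtuallyOpen.nullMeasurableSet {X Y : Type*} [MeasurableSpace X] [MeasurableSpace Y]
    {μ : Measure X} {ν : Measure Y} {W : Set (X × Y)} (hW : IsVirtuallyOpen μ ν W)
    {lam : Measure (X × Y)} (h : IsBistochastic μ ν lam) : NullMeasurableSet W lam := by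
  obtain ⟨-, X', Y', hX', hY', hμ, hν, A, B, hA, hB, hAB⟩ := hW
  have hm : MeasurableSet (W ∩ X' ×ˢ Y') :=
    hAB ▸ MeasurableSet.iUnion fun i => (hA i).prod (hB i)
  have h1 : ∀ᵐ z ∂lam, z.1 ∈ X' := by
    rw [← h.measure_fst_preimage hX'.compl] at hμ; exact hμ
  have h2 : ∀ᵐ z ∂lam, z.2 ∈ Y' := by
    rw [← h.measure_snd_preimage hY'.compl] at hν; exact hν
  refine hm.nullMeasurableSet.congr ?_
  filter_upwards [h1, h2] with z hz1 hz2
  exact propext ⟨fun hz => hz.1, fun hz => ⟨hz, hz1, hz2⟩⟩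

/-! ### Weak limits -/

/-- If bistochastic measures on a compact product give mass at least `c` to the successive members
of a decreasing sequence of closed sets, a weak limit gives mass at least `c` to the intersection. -/
theorem exists_isBistochastic_le_measure_iInter {P Q : Type*}
    [TopologicalSpace P] [CompactSpace P] [TopologicalSpace.MetrizableSpace P] [MeasurableSpace P]
    [BorelSpace P] [TopologicalSpace Q] [CompactSpace Q] [TopologicalSpace.MetrizableSpace Q]
    [MeasurableSpace Q] [BorelSpace Q]
    {μ : Measure P} {ν : Measure Q} [IsProbabilityMeasure μ]
    {K : ℕ → Set (P × Q)} (hK : ∀ m, IsClosed (K m)) (hanti : Antitone K) {c : ℝ≥0∞}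
    {lam : ℕ → Measure (P × Q)} (hlam : ∀ n, IsBistochastic μ ν (lam n))
    (hc : ∀ n, c ≤ lam n (K n)) :
    ∃ lam' : Measure (P × Q), IsBistochastic μ ν lam' ∧ c ≤ lam' (⋂ m, K m) := by
  have : SecondCountableTopology P := by
    let := TopologicalSpace.metrizableSpaceMetric P
    infer_instance
  have : SecondCountableTopology Q := by
    let := TopologicalSpace.metrizableSpaceMetric Q
    infer_instance
  let κ : ℕ → ProbabilityMeasure (P × Q) := fun n => ⟨lam n, (hlam n).isProbabilityMeasure⟩
  -- A limit along a nonprincipal ultrafilter avoids extracting a subsequence.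
  obtain ⟨κ', -, hκ'⟩ := isCompact_univ.ultrafilter_le_nhds
    ((Filter.hyperfilter ℕ).map κ) (by simp)
  have hlim : Filter.Tendsto κ (Filter.hyperfilter ℕ) (nhds κ') := hκ'
  refine ⟨κ', ⟨?_, ?_⟩, ?_⟩
  · have h := ProbabilityMeasure.tendsto_map_of_tendsto_of_continuous κ κ' hlim continuous_fst
    have h' : (fun n => (κ n).map continuous_fst.measurable.aemeasurable) =
        fun _ => (⟨μ, inferInstance⟩ : ProbabilityMeasure P) :=
      funext fun n => Subtype.ext (hlam n).1
    rw [h'] at h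
    exact congrArg ProbabilityMeasure.toMeasure (tendsto_nhds_unique h tendsto_const_nhds)
  · have h := ProbabilityMeasure.tendsto_map_of_tendsto_of_continuous κ κ' hlim continuous_snd
    have hν : IsProbabilityMeasure ν := by
      have := (hlam 0).isProbabilityMeasure
      rw [← (hlam 0).2]
      exact Measure.isProbabilityMeasure_map measurable_snd.aemeasurable
    have h' : (fun n => (κ n).map continuous_snd.measurable.aemeasurable) =
        fun _ => (⟨ν, hν⟩ : ProbabilityMeasure Q) :=
      funext fun n => Subtype.ext (hlam n).2
    rw [h'] at h
    exact congrArg ProbabilityMeasure.toMeasure (tendsto_nhds_unique h tendsto_const_nhds)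
  · rw [hanti.measure_iInter (fun m => (hK m).measurableSet.nullMeasurableSet)
      ⟨0, measure_ne_top _ _⟩]
    -- For fixed m, all n ≥ m satisfy lam n (K m) ≥ lam n (K n) ≥ c, and the portmanteau inequality
    -- passes this to the limit because K m is closed.
    refine le_iInf fun m => le_trans ?_
      (ProbabilityMeasure.limsup_measure_closed_le_of_tendsto hlim (hK m))
    refine Filter.le_limsup_of_frequently_le (Filter.Eventually.frequently ?_)
    have : ∀ᶠ n in (Filter.hyperfilter ℕ : Filter ℕ), m ≤ n :=
      (Nat.hyperfilter_le_atTop) (Filter.eventually_ge_atTop m)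
    exact this.mono fun n hn => (hc n).trans (measure_mono (hanti hn))

/-- Almost everywhere in a coded model, points of the preimage of a set carry its code. -/
theorem ae_map_code {X I : Type*} [MeasurableSpace X] [MeasurableSpace I] {μ : Measure X}
    {g : X → I × (ℕ → Bool)} {h : I × (ℕ → Bool) → X} (hg : Measurable g)
    {A : ℕ → Set X} (hA : ∀ i, MeasurableSet (A i)) (hgA : ∀ x i, (g x).2 i = true ↔ x ∈ A i)
    (hh : ∀ s, MeasurableSet s → NullMeasurableSet (h ⁻¹' s) (μ.map g))
    (hgh : ∀ᵐ x ∂μ, h (g x) = x) :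
    ∀ᵐ p ∂μ.map g, ∀ i, h p ∈ A i → p.2 i = true := by
  rw [ae_all_iff]
  intro i
  have hn : NullMeasurableSet {p | h p ∈ A i → p.2 i = true} (μ.map g) := by
    have e : {p | h p ∈ A i → p.2 i = true} = (h ⁻¹' A i)ᶜ ∪ {p | p.2 i = true} := by
      ext p; simp [imp_iff_not_or]
    rw [e]
    refine (hh _ (hA i)).compl.union (MeasurableSet.nullMeasurableSet ?_)
    exact (by fun_prop : Measurable fun p : I × (ℕ → Bool) => p.2 i) (measurableSet_singleton true)
  -- The image measure is tested on points g x, where the code is faithful by construction as soon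
  -- as h (g x) = x.
  change μ.map g {p | h p ∈ A i → p.2 i = true}ᶜ = 0
  rw [Measure.map_apply₀ hg.aemeasurable hn.compl]
  change ∀ᵐ x ∂μ, h (g x) ∈ A i → (g x).2 i = true
  filter_upwards [hgh] with x hx
  rw [hx, hgA]
  exact id

/-! ### Attainment and conclusion -/

/-- The proper thickness of a virtually closed set is attained by a bistochastic measure. -/
theorem IsVirtuallyClosed.exists_properThickness_le {X Y : Type*} [MeasurableSpace X]
    [MeasurableSpace Y] {μ : Measure X} {ν : Measure Y} (hμ : IsLebesgueRokhlin μ)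
    (hν : IsLebesgueRokhlin ν) {Z : Set (X × Y)} (hZ : IsVirtuallyClosed μ ν Z) :
    ∃ lam : Measure (X × Y), IsBistochastic μ ν lam ∧ properThickness μ ν Z ≤ lam Z := by
  have := hμ.isProbabilityMeasure
  have := hν.isProbabilityMeasure
  obtain ⟨-, X', Y', hX', hY', hμ', hν', A, B, hA, hB, hAB⟩ := hZ
  obtain ⟨g, h, hg, hgA, hh, hgh⟩ := hμ.exists_compact_model A hA
  obtain ⟨g', h', hg', hgB, hh', hgh'⟩ := hν.exists_compact_model B hB
  have hG : Measurable (Prod.map g g') := hg.prodMap hg'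
  let K : ℕ → Set ((unitInterval × (ℕ → Bool)) × (unitInterval × (ℕ → Bool))) :=
    fun m => {z | ∀ i < m, ¬ (z.1.2 i = true ∧ z.2.2 i = true)}
  have hK : ∀ m, IsClosed (K m) := by
    intro m
    simp only [K, Set.ofPred_forall]
    refine isClosed_iInter fun i => isClosed_iInter fun _ => ?_
    have hc : Continuous fun z : (unitInterval × (ℕ → Bool)) × (unitInterval × (ℕ → Bool)) =>
        (z.1.2 i, z.2.2 i) := by fun_prop
    exact (isClosed_discrete {b : Bool × Bool | ¬ (b.1 = true ∧ b.2 = true)}).preimage hc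
  have hanti : Antitone K := fun m n hmn z hz i hi => hz i (hi.trans_le hmn)
  have hfin : ∀ n, ∃ lam : Measure (X × Y), IsBistochastic μ ν lam ∧
      properThickness μ ν Z ≤ lam (Prod.map g g' ⁻¹' K n) := by
    intro n
    let π : X → Fin n → Bool := fun x i => (g x).2 i
    let ρ : Y → Fin n → Bool := fun y i => (g' y).2 i
    have hπ : Measurable π := by fun_prop
    have hρ : Measurable ρ := by fun_prop
    obtain ⟨lam, hlam, S, T, hcov, hle⟩ := exists_isBistochastic_cover_le μ ν hπ hρ
      (fun a b => ∀ i, ¬ (a i = true ∧ b i = true))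
    -- Adding the null complements of X' and Y' makes the cell cover an honest cover of all of Z
    -- without changing its cost: inside X' × Y' a point of Z lies in no rectangle, so its cells are
    -- related.
    refine ⟨lam, hlam, le_trans (sInf_le ⟨π ⁻¹' S ∪ X'ᶜ, ρ ⁻¹' T ∪ Y'ᶜ,
      (hπ S.toFinite.measurableSet).union hX'.compl, (hρ T.toFinite.measurableSet).union hY'.compl,
      ?_, rfl⟩) (le_trans ?_ (hle.trans (measure_mono ?_)))⟩
    · rintro ⟨x, y⟩ hz
      by_cases hx : x ∈ X'
      · by_cases hy : y ∈ Y'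
        · have hR : ∀ i, ¬ (π x i = true ∧ ρ y i = true) := by
            rintro i ⟨h1, h2⟩
            have : (x, y) ∈ Zᶜ ∩ X' ×ˢ Y' := by
              rw [hAB]
              exact Set.mem_iUnion.2 ⟨i, (hgA x i).1 h1, (hgB y i).1 h2⟩
            exact this.1 hz
          rcases hcov _ _ hR with h | h
          · exact Or.inl ⟨Or.inl h, trivial⟩
          · exact Or.inr ⟨trivial, Or.inl h⟩
        · exact Or.inr ⟨trivial, Or.inr hy⟩
      · exact Or.inl ⟨Or.inr hx, trivial⟩
    · refine add_le_add ((measure_union_le _ _).trans ?_) ((measure_union_le _ _).trans ?_)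
      · rw [hμ', add_zero]
      · rw [hν', add_zero]
    · exact fun z hz i hi => hz ⟨i, hi⟩
  choose lam hlam hle using hfin
  have : IsProbabilityMeasure (μ.map g) := Measure.isProbabilityMeasure_map hg.aemeasurable
  obtain ⟨lam', hlam', hle'⟩ := exists_isBistochastic_le_measure_iInter (μ := μ.map g)
    (ν := ν.map g') hK hanti (c := properThickness μ ν Z)
    (lam := fun n => (lam n).map (Prod.map g g'))
    (fun n => by
      constructor
      · rw [Measure.map_map measurable_fst hG, ← (hlam n).1, Measure.map_map hg measurable_fst]
        rfl
      · rw [Measure.map_map measurable_snd hG, ← (hlam n).2, Measure.map_map hg' measurable_snd]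
        rfl)
    (fun n => by rw [Measure.map_apply hG (hK n).measurableSet]; exact hle n)
  obtain ⟨lam₀, hlam₀, happ⟩ := exists_isBistochastic_of_map hg hg' hh hh' hgh hgh' hlam'
  refine ⟨lam₀, hlam₀, ?_⟩
  have hWm : MeasurableSet (⋃ i, A i ×ˢ B i) := MeasurableSet.iUnion fun i => (hA i).prod (hB i)
  have hXc : ∀ᵐ z ∂lam₀, z.1 ∈ X' := by
    rw [← hlam₀.measure_fst_preimage hX'.compl] at hμ'; exact hμ'
  have hYc : ∀ᵐ z ∂lam₀, z.2 ∈ Y' := by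
    rw [← hlam₀.measure_snd_preimage hY'.compl] at hν'; exact hν'
  have hZW : lam₀ (⋃ i, A i ×ˢ B i)ᶜ ≤ lam₀ Z := by
    refine measure_mono_ae ?_
    filter_upwards [hXc, hYc] with z hx hy hz
    by_contra hzZ
    exact hz (hAB ▸ ⟨hzZ, hx, hy⟩)
  have hcode : ∀ᵐ z ∂lam', ∀ i, h z.1 ∈ A i → z.1.2 i = true := by
    have h1 := ae_map_code hg hA hgA hh hgh
    rw [← hlam'.1] at h1
    exact ae_of_ae_map measurable_fst.aemeasurable h1
  have hcode' : ∀ᵐ z ∂lam', ∀ i, h' z.2 ∈ B i → z.2.2 i = true := by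
    have h1 := ae_map_code hg' hB hgB hh' hgh'
    rw [← hlam'.2] at h1
    exact ae_of_ae_map measurable_snd.aemeasurable h1
  -- Codes forbid rectangles in the model, so almost every point of the intersection of the K m is
  -- sent outside every A i × B i. Only the implication from membership to code is needed.
  refine hle'.trans (le_trans ?_ hZW)
  rw [happ _ hWm.compl]
  refine measure_mono_ae ?_
  filter_upwards [hcode, hcode'] with z hz hz' hzK hmem
  obtain ⟨i, hi, hi'⟩ := Set.mem_iUnion.1 hmem
  -- K m constrains the indices below m, so rectangle i is excluded from stage i + 1 on.
  exact Set.mem_iInter.1 hzK (i + 1) i i.lt_succ_self ⟨hz i hi, hz' i hi'⟩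

theorem mainTheorem4 {X Y : Type*} [MeasurableSpace X] [MeasurableSpace Y]
    (μ : Measure X) (ν : Measure Y) (hμ : IsLebesgueRokhlin μ) (hν : IsLebesgueRokhlin ν)
    (Z : Set (X × Y)) (hZ : IsVirtuallyClosed μ ν Z) :
    (∀ lam : Measure (X × Y), IsBistochastic μ ν lam → NullMeasurableSet Z lam) ∧
    ((∃ lam : Measure (X × Y), IsBistochastic μ ν lam ∧ lam Z = 1) ↔
      properThickness μ ν Z = 1) ∧
    IsGreatest {r : ℝ≥0∞ | ∃ lam : Measure (X × Y), IsBistochastic μ ν lam ∧ r = lam Z}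
      (properThickness μ ν Z) := by
  have := hμ.isProbabilityMeasure
  obtain ⟨lam, hlam, hle⟩ := hZ.exists_properThickness_le hμ hν
  have heq : properThickness μ ν Z = lam Z := le_antisymm hle (hlam.measure_le_properThickness Z)
  refine ⟨fun l hl => (IsVirtuallyOpen.nullMeasurableSet hZ hl).of_compl, ⟨?_, fun h => ?_⟩,
    ⟨lam, hlam, heq⟩, ?_⟩
  · rintro ⟨l, hl, h1⟩
    exact le_antisymm (properThickness_le_one μ ν Z) (h1 ▸ hl.measure_le_properThickness Z)
  · exact ⟨lam, hlam, heq ▸ h⟩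
  · rintro _ ⟨l, hl, rfl⟩
    exact hl.measure_le_properThickness Z
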